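/- Let $\mathbb{Z}$ be the infinite chain, i.e. the graph with vertex set $\mathbb{Z}$ and edges $\{x,y\}$, $|x-y|=1$. For $N\ge 0$ let $\mathcal V_N$ be the set of $N$-element subsets of $\mathbb{Z}$, and for $X\in\mathcal V_N$ let $S(X)$ be the number of edges with exactly one endpoint in $X$. For real $\Delta$ with $\Delta>1$ let $H^N$ be the bounded operator on the complex Hilbert space $\ell^2(\mathcal V_N)$ given by $$(H^Nf)(X)=-\frac1{2\Delta}\sum_{Y\in\mathcal V_N:\ X\triangle Y\text{ is an edge}}f(Y)+\frac12 S(X)f(X)$$ (so $H^0=0$), and let $H=\bigoplus_{N=0}^\infty H^N$ be the Hamiltonian of the infinite XXZ chain, the operator on $\bigoplus_{N=0}^\infty\ell^2(\mathcal V_N)$ with domain $\{(f_N)_N:\sum_N\|H^Nf_N\|^2<\infty\}$. For $k\in\mathbb{N}$ let $\mathcal C(k)=[k(1-\frac1\Delta),k(1+\frac1\Delta)]$ be the $k$-th cluster band, and for $\Delta\ge 4k+1$ put $$\gamma_\pm(k,\Delta)=k+\frac12\Big(1-\frac1\Delta\Big)\pm\frac1{2\Delta}\sqrt{(\Delta-1)(\Delta-(4k+1))}.$$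 **Proposition.** Let $k\ge2$ be an integer and let $\Delta>4k+1$. Then the open interval $(\gamma_-(k,\Delta),\gamma_+(k,\Delta))$ is non-empty and is contained in $\big(k(1+\frac1\Delta),(k+1)(1-\frac1\Delta)\big)$; thus it lies strictly above $\mathcal C(k)$ and strictly below $\mathcal C(k+1)$. It is contained in the resolvent set of $H$, and in the resolvent set of $H^N$ for every $N\ge0$. -/

import Mathlib

noncomputable section

namespace XXZ

/-! ### Graphs of bounded degree and symmetric products -/

/-- The graph `G` has bounded degree. -/
def BoundedDegree {V : Type*} (G : SimpleGraph V) : Prop :=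
  ∃ d : ℕ, ∀ x, (G.neighborSet x).Finite ∧ (G.neighborSet x).ncard ≤ d

/-- The configurations of `N` particles: the subsets of `V` with exactly `N` elements. -/
abbrev Config (V : Type*) (N : ℕ) : Type _ := {X : Finset V // X.card = N}

/-- The `N`-th symmetric product of `G`: its vertices are the `N`-element subsets of `V`, and
`X`, `Y` are adjacent when the symmetric difference of `X` and `Y` is an edge of `G`. -/
def symProd {V : Type*} [DecidableEq V] (G : SimpleGraph V) (N : ℕ) :
    SimpleGraph (Config V N) where
  Adj X Y := ∃ x y, G.Adj x y ∧ symmDiff X.1 Y.1 = {x, y}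
  symm := ⟨fun X Y ⟨x, y, h, e⟩ => ⟨x, y, h, by rw [symmDiff_comm]; exact e⟩⟩
  loopless := ⟨fun X ⟨x, y, _, e⟩ => by
    have h : x ∈ symmDiff X.1 X.1 := by rw [e]; simp
    simp at h⟩

/-- The edge boundary of `X`: the edges of `G` with one end in `X` and the other outside `X`. -/
def edgeBoundary {V : Type*} (G : SimpleGraph V) (X : Finset V) : Set (Sym2 V) :=
  {e | ∃ x ∈ X, ∃ y ∉ X, G.Adj x y ∧ e = s(x, y)}

/-- The surface measure `S(X)`, the number of edges in the edge boundary of `X`. -/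
def surface {V : Type*} (G : SimpleGraph V) (X : Finset V) : ℕ := (edgeBoundary G X).ncard

theorem surface_bounded {V : Type*} [DecidableEq V] {G : SimpleGraph V} (hG : BoundedDegree G)
    (N : ℕ) : ∃ C : ℕ, ∀ X : Config V N, surface G X.1 ≤ C := by
  obtain ⟨d, hd⟩ := hG
  refine ⟨N * d, fun X => ?_⟩
  let F : Finset (Sym2 V) :=
    X.1.biUnion fun x => (hd x).1.toFinset.image fun y => s(x, y)
  have hsub : edgeBoundary G X.1 ⊆ (F : Set (Sym2 V)) := by
    rintro e ⟨x, hx, y, -, hxy, rfl⟩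
    simp only [F, Finset.coe_biUnion, Set.mem_iUnion]
    exact ⟨x, hx, by
      rw [Finset.mem_coe, Finset.mem_image]
      exact ⟨y, by simpa using hxy, rfl⟩⟩
  have h1 : surface G X.1 ≤ F.card := by
    have := Set.ncard_le_ncard hsub F.finite_toSet
    rwa [Set.ncard_coe_finset] at this
  have h2 : F.card ≤ X.1.card * d := by
    refine Finset.card_biUnion_le_card_mul _ _ _ fun x _ => Finset.card_image_le.trans ?_
    rw [← Set.ncard_eq_toFinset_card _ (hd x).1]
    exact (hd x).2
  rw [X.2] at h2
  exact h1.trans h2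

theorem symProd_boundedDegree {V : Type*} [DecidableEq V] {G : SimpleGraph V}
    (hG : BoundedDegree G) (N : ℕ) : BoundedDegree (symProd G N) := by
  obtain ⟨d, hd⟩ := hG
  refine ⟨N * d, fun X => ?_⟩
  let F : Finset (Finset V) :=
    X.1.biUnion fun x => (hd x).1.toFinset.image fun y => symmDiff X.1 {x, y}
  have key : ∀ Y : Config V N, (symProd G N).Adj X Y → Y.1 ∈ F := by
    rintro Y ⟨x, y, hxy, e⟩
    have hY : Y.1 = symmDiff X.1 {x, y} := by rw [← e, symmDiff_symmDiff_cancel_left]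
    -- one of the two ends belongs to `X`, as otherwise `Y` would have more elements than `X`
    have hor : x ∈ X.1 ∨ y ∈ X.1 := by
      by_contra hcon
      push Not at hcon
      have hdis : Disjoint X.1 {x, y} := by
        rw [Finset.disjoint_right]
        intro z hz
        rcases Finset.mem_insert.1 hz with rfl | hz
        · exact hcon.1
        · rw [Finset.mem_singleton.1 hz]; exact hcon.2
      have hc : Y.1.card = X.1.card + 2 := by
        rw [hY, hdis.symmDiff_eq_sup, Finset.sup_eq_union, Finset.card_union_of_disjoint hdis,
          Finset.card_pair hxy.ne]
      have := X.2
      have := Y.2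
      omega
    simp only [F, Finset.mem_biUnion, Finset.mem_image]
    rcases hor with h | h
    · exact ⟨x, h, y, by simpa using hxy, hY.symm⟩
    · exact ⟨y, h, x, by simpa using hxy.symm, by rw [hY, Finset.pair_comm]⟩
  have hmaps : Set.MapsTo (fun Y : Config V N => Y.1) ((symProd G N).neighborSet X)
      (F : Set (Finset V)) := fun Y hY => key Y hY
  have hinj : Set.InjOn (fun Y : Config V N => Y.1) ((symProd G N).neighborSet X) :=
    Subtype.val_injective.injOn
  refine ⟨Set.Finite.of_injOn hmaps hinj F.finite_toSet, ?_⟩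
  have h1 := Set.ncard_le_ncard_of_injOn _ hmaps hinj F.finite_toSet
  rw [Set.ncard_coe_finset] at h1
  have h2 : F.card ≤ X.1.card * d := by
    refine Finset.card_biUnion_le_card_mul _ _ _ fun x _ => Finset.card_image_le.trans ?_
    rw [← Set.ncard_eq_toFinset_card _ (hd x).1]
    exact (hd x).2
  rw [X.2] at h2
  exact h1.trans h2

/-! ### Multiplication and adjacency operators on `ℓ²` -/

/-- The complex Hilbert space `ℓ²(W)`. -/
abbrev Ell2 (W : Type*) : Type _ := lp (fun _ : W => ℂ) 2

/-- A linear map on functions with an `ℓ²`-bound on finite sets, as an operator on `ℓ²(W)`. -/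
def ofBound {W : Type*} (T : (W → ℂ) →ₗ[ℂ] (W → ℂ))
    (h : ∃ C : ℝ, 0 ≤ C ∧ ∀ (f : Ell2 W) (s : Finset W), ∑ x ∈ s, ‖T f x‖ ^ 2 ≤ (C * ‖f‖) ^ 2) :
    Ell2 W →L[ℂ] Ell2 W :=
  LinearMap.mkContinuousOfExistsBound
    { toFun := fun f => ⟨T f, by
        obtain ⟨C, -, hb⟩ := h
        exact memℓp_gen' (C := (C * ‖f‖) ^ 2) (fun s => by simpa using hb f s)⟩
      map_add' := fun f g => by ext x; exact congrFun (map_add T (f : W → ℂ) (g : W → ℂ)) x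
      map_smul' := fun c f => by ext x; exact congrFun (map_smul T c (f : W → ℂ)) x }
    (by
      obtain ⟨C, hC, hb⟩ := h
      refine ⟨C, fun f => ?_⟩
      refine lp.norm_le_of_forall_sum_le (by norm_num) (by positivity) fun s => ?_
      simpa using hb f s)

@[simp] theorem ofBound_apply {W : Type*} (T : (W → ℂ) →ₗ[ℂ] (W → ℂ)) (h) (f : Ell2 W) (x : W) :
    ofBound T h f x = T f x := rfl

theorem sum_sq_le {W : Type*} (f : Ell2 W) (s : Finset W) : ∑ x ∈ s, ‖f x‖ ^ 2 ≤ ‖f‖ ^ 2 := by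
  simpa using lp.sum_rpow_le_norm_rpow (p := 2) (by norm_num) f s

/-- Multiplication by the function `u`, on functions. -/
def mulFun {W : Type*} (u : W → ℕ) : (W → ℂ) →ₗ[ℂ] (W → ℂ) where
  toFun f x := (u x : ℂ) * f x
  map_add' f g := by ext x; simp [mul_add]
  map_smul' c f := by ext x; simp [mul_left_comm]

/-- The operator of multiplication by the bounded function `u` on `ℓ²(W)`. -/
def mulOp {W : Type*} (u : W → ℕ) (hu : ∃ C : ℕ, ∀ x, u x ≤ C) : Ell2 W →L[ℂ] Ell2 W :=
  ofBound (mulFun u) (by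
    obtain ⟨C, hC⟩ := hu
    refine ⟨C, by positivity, fun f s => ?_⟩
    calc ∑ x ∈ s, ‖mulFun u f x‖ ^ 2 ≤ ∑ x ∈ s, (C : ℝ) ^ 2 * ‖f x‖ ^ 2 := by
          refine Finset.sum_le_sum fun x _ => ?_
          have : (u x : ℝ) ≤ C := by exact_mod_cast hC x
          simp only [mulFun, LinearMap.coe_mk, AddHom.coe_mk, norm_mul, Complex.norm_natCast,
            mul_pow]
          gcongr
      _ = (C : ℝ) ^ 2 * ∑ x ∈ s, ‖f x‖ ^ 2 := by rw [Finset.mul_sum]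
      _ ≤ (C : ℝ) ^ 2 * ‖f‖ ^ 2 := by gcongr; exact sum_sq_le f s
      _ = (C * ‖f‖) ^ 2 := by ring)

/-- The finite set of neighbours of `x` in a graph of bounded degree. -/
def nbrs {W : Type*} (G : SimpleGraph W) (hG : BoundedDegree G) (x : W) : Finset W :=
  (show (G.neighborSet x).Finite from (hG.choose_spec x).1).toFinset

@[simp] theorem mem_nbrs {W : Type*} (G : SimpleGraph W) (hG : BoundedDegree G) (x y : W) :
    y ∈ nbrs G hG x ↔ G.Adj x y := by
  simp [nbrs]

theorem card_nbrs_le {W : Type*} (G : SimpleGraph W) (hG : BoundedDegree G) :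
    ∃ d : ℕ, ∀ x, (nbrs G hG x).card ≤ d :=
  ⟨hG.choose, fun x => by
    rw [nbrs, ← Set.ncard_eq_toFinset_card _ (hG.choose_spec x).1]; exact (hG.choose_spec x).2⟩

/-- The adjacency operator `(A f)(x) = ∑_{y ∼ x} f(y)`, on functions. -/
def adjFun {W : Type*} (G : SimpleGraph W) (hG : BoundedDegree G) :
    (W → ℂ) →ₗ[ℂ] (W → ℂ) where
  toFun f x := ∑ y ∈ nbrs G hG x, f y
  map_add' f g := by ext x; simp [Finset.sum_add_distrib]
  map_smul' c f := by ext x; simp [Finset.mul_sum]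

/-- The adjacency operator of a graph of bounded degree on `ℓ²(W)`. -/
def adjOp {W : Type*} (G : SimpleGraph W) (hG : BoundedDegree G) : Ell2 W →L[ℂ] Ell2 W :=
  ofBound (adjFun G hG) (by
    classical
    obtain ⟨d, hd⟩ := card_nbrs_le G hG
    refine ⟨d, by positivity, fun f s => ?_⟩
    have h1 : ∀ x ∈ s, ‖adjFun G hG f x‖ ^ 2 ≤ d * ∑ y ∈ nbrs G hG x, ‖f y‖ ^ 2 := by
      intro x _
      calc ‖adjFun G hG f x‖ ^ 2 ≤ (∑ y ∈ nbrs G hG x, ‖f y‖) ^ 2 := by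
            gcongr; exact norm_sum_le _ _
        _ ≤ (nbrs G hG x).card * ∑ y ∈ nbrs G hG x, ‖f y‖ ^ 2 := sq_sum_le_card_mul_sum_sq
        _ ≤ d * ∑ y ∈ nbrs G hG x, ‖f y‖ ^ 2 := by gcongr; exact hd x
    let t := s.biUnion (nbrs G hG)
    have h2 : ∑ x ∈ s, ∑ y ∈ nbrs G hG x, ‖f y‖ ^ 2 =
        ∑ y ∈ t, ∑ x ∈ s with y ∈ nbrs G hG x, ‖f y‖ ^ 2 := by
      refine Finset.sum_comm' fun x y => ?_
      simp only [t, Finset.mem_biUnion, Finset.mem_filter]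
      exact ⟨fun h => ⟨h, x, h⟩, fun h => h.1⟩
    have h3 : ∀ y ∈ t, ∑ x ∈ s with y ∈ nbrs G hG x, ‖f y‖ ^ 2 ≤ d * ‖f y‖ ^ 2 := by
      intro y _
      rw [Finset.sum_const, nsmul_eq_mul]
      gcongr
      refine (Finset.card_le_card fun x hx => ?_).trans (hd y)
      simpa [SimpleGraph.adj_comm] using (Finset.mem_filter.1 hx).2
    calc ∑ x ∈ s, ‖adjFun G hG f x‖ ^ 2
        ≤ ∑ x ∈ s, d * ∑ y ∈ nbrs G hG x, ‖f y‖ ^ 2 := Finset.sum_le_sum h1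
      _ = d * ∑ y ∈ t, ∑ x ∈ s with y ∈ nbrs G hG x, ‖f y‖ ^ 2 := by
          rw [← Finset.mul_sum, h2]
      _ ≤ d * ∑ y ∈ t, d * ‖f y‖ ^ 2 := by gcongr with y hy; exact h3 y hy
      _ = (d : ℝ) ^ 2 * ∑ y ∈ t, ‖f y‖ ^ 2 := by rw [← Finset.mul_sum]; ring
      _ ≤ (d : ℝ) ^ 2 * ‖f‖ ^ 2 := by gcongr; exact sum_sq_le f t
      _ = (d * ‖f‖) ^ 2 := by ring)

/-! ### The XXZ Hamiltonian -/

/-- The `N`-particle Hamiltonian `H^N = -(1/(2Δ)) A_N + (1/2) D_N` on `ℓ²(V_N)`, where `A_N` is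
the adjacency operator of the `N`-th symmetric product of `G` and `D_N` is multiplication by the
surface measure. -/
def hamN {V : Type*} [DecidableEq V] (G : SimpleGraph V) (hG : BoundedDegree G) (Δ : ℝ) (N : ℕ) :
    Ell2 (Config V N) →L[ℂ] Ell2 (Config V N) :=
  (-(1 / (2 * (Δ : ℂ)))) • adjOp (symProd G N) (symProd_boundedDegree hG N) +
    (1 / 2 : ℂ) • mulOp (fun X : Config V N => surface G X.1) (surface_bounded hG N)

/-- The Hilbert space direct sum of the spaces `E i`. -/
abbrev HilbertSum {ι : Type*} (E : ι → Type*) [∀ i, NormedAddCommGroup (E i)] : Type _ := lp E 2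

/-- The direct sum of the bounded operators `T i`, as an (in general unbounded) operator with
its natural domain of all `f = (f i)` such that `∑ ‖f i‖ ^ 2` and `∑ ‖T i (f i)‖ ^ 2` are finite. -/
def directSum {ι : Type*} {E : ι → Type*} [∀ i, NormedAddCommGroup (E i)]
    [∀ i, NormedSpace ℂ (E i)] (T : ∀ i, E i →L[ℂ] E i) :
    HilbertSum E →ₗ.[ℂ] HilbertSum E where
  domain :=
    { carrier := {f | Memℓp (fun i => T i (f i)) 2}
      add_mem' := fun {f g} hf hg => by
        have h : (fun i => T i ((f + g) i)) = (fun i => T i (f i)) + fun i => T i (g i) := by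
          ext i; simp
        rw [Set.mem_ofPred_eq, h]
        exact Memℓp.add hf hg
      zero_mem' := by
        have h : (fun i => T i ((0 : HilbertSum E) i)) = 0 := by ext i; simp
        rw [Set.mem_ofPred_eq, h]
        exact zero_memℓp
      smul_mem' := fun c f hf => by
        have h : (fun i => T i ((c • f) i)) = c • fun i => T i (f i) := by ext i; simp
        rw [Set.mem_ofPred_eq, h]
        exact Memℓp.const_smul hf c }
  toFun :=
    { toFun := fun f => ⟨fun i => T i (f.1 i), f.2⟩
      map_add' := fun f g => by ext i; exact map_add (T i) (f.1 i) (g.1 i)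
      map_smul' := fun c f => by ext i; exact map_smul (T i) c (f.1 i) }

/-- The full XXZ Hamiltonian on `G`: the direct sum of all `H^N`, `N ≥ 0`, on the direct sum of the
Hilbert spaces `ℓ²(V_N)`. -/
def ham {V : Type*} [DecidableEq V] (G : SimpleGraph V) (hG : BoundedDegree G) (Δ : ℝ) :
    HilbertSum (fun N : ℕ => Ell2 (Config V N)) →ₗ.[ℂ]
      HilbertSum (fun N : ℕ => Ell2 (Config V N)) :=
  directSum fun N => hamN G hG Δ N

/-- The resolvent set of a possibly unbounded operator `T`: all `z` such that `T - z` is a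
bijection from the domain of `T` onto the whole space whose inverse `R` is bounded. -/
def pmapResolventSet {E : Type*} [NormedAddCommGroup E] [NormedSpace ℂ E] (T : E →ₗ.[ℂ] E) :
    Set ℂ :=
  {z | ∃ R : E →L[ℂ] E,
    (∀ y, ∃ h : R y ∈ T.domain, T ⟨R y, h⟩ - z • R y = y) ∧
    ∀ x : T.domain, R (T x - z • (x : E)) = x}

/-! ### The chain -/

/-- The chain: the graph on `ℤ` whose edges are the pairs `{x, y}` with `|x - y| = 1`. -/
def chain : SimpleGraph ℤ where
  Adj x y := |x - y| = 1
  symm := ⟨fun x y h => by rw [abs_sub_comm]; exact h⟩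
  loopless := ⟨fun x h => by simp at h⟩

theorem chain_boundedDegree : BoundedDegree chain := by
  refine ⟨2, fun x => ?_⟩
  have hsub : chain.neighborSet x ⊆ (({x - 1, x + 1} : Finset ℤ) : Set ℤ) := by
    intro y hy
    have h : |x - y| = 1 := hy
    simp only [Finset.coe_insert, Finset.coe_singleton, Set.mem_insert_iff,
      Set.mem_singleton_iff]
    rcases (abs_eq (by norm_num)).1 h with h | h
    · left; omega
    · right; omega
  refine ⟨(Finset.finite_toSet _).subset hsub, ?_⟩
  have := Set.ncard_le_ncard hsub (Finset.finite_toSet _)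
  rw [Set.ncard_coe_finset] at this
  exact this.trans Finset.card_le_two

/-- The `N`-particle Hamiltonian of the infinite XXZ chain. -/
def chainHamN (Δ : ℝ) (N : ℕ) : Ell2 (Config ℤ N) →L[ℂ] Ell2 (Config ℤ N) :=
  hamN chain chain_boundedDegree Δ N

/-- The Hamiltonian of the infinite XXZ chain. -/
def chainHam (Δ : ℝ) :
    HilbertSum (fun N : ℕ => Ell2 (Config ℤ N)) →ₗ.[ℂ]
      HilbertSum (fun N : ℕ => Ell2 (Config ℤ N)) :=
  ham chain chain_boundedDegree Δ

/-- The `k`-th cluster band `[k(1 - 1/Δ), k(1 + 1/Δ)]`. -/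
def clusterBand (k : ℕ) (Δ : ℝ) : Set ℝ := Set.Icc (k * (1 - 1 / Δ)) (k * (1 + 1 / Δ))

/-- The left end `γ₋(k, Δ)` of the gap. -/
def gammaMinus (k : ℕ) (Δ : ℝ) : ℝ :=
  k + 1 / 2 * (1 - 1 / Δ) - 1 / (2 * Δ) * √((Δ - 1) * (Δ - (4 * k + 1)))

/-- The right end `γ₊(k, Δ)` of the gap. -/
def gammaPlus (k : ℕ) (Δ : ℝ) : ℝ :=
  k + 1 / 2 * (1 - 1 / Δ) + 1 / (2 * Δ) * √((Δ - 1) * (Δ - (4 * k + 1)))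

end XXZ

end

noncomputable section
namespace XXZ

open scoped InnerProductSpace

/-! ### Coercivity of a weighted graph Hamiltonian -/

section Weighted

variable {W : Type*}

/-! On the chain a configuration `X` has at most `S(X)` neighbours, so the adjacency form is
dominated by the surface form: `∑ |Af||f| ≤ ∑ S |f|²` (`tsum_norm_adjOp_mul_le`). Let `U` be the
sign of the diagonal part `S/2 - E`. Then `Re ⟪U(H^N - E)f, f⟫ ≥ ∑ (|S/2 - E| - S/(2Δ)) |f|²`, since
`U` turns the diagonal into its absolute value and leaves the bound on the hopping term unchanged.

Moreover `S = 2w` with `w` the number of clusters, so the coefficient is `|w - E| - w/Δ`, which is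
positive exactly when `E` lies outside the band `[w(1 - 1/Δ), w(1 + 1/Δ)]`. If `E` lies strictly
between the `k`-th and `(k+1)`-st bands, the coefficient is at least some `c > 0` for all `w`.
Coercivity makes `U(H^N - E)`, hence `H^N - E`, invertible, and since `c` does not depend on `N` the
inverses sum to a bounded inverse of `H - E`.

The whole gap between the two bands is thus free of spectrum; an elementary estimate of the square
root places `(γ₋, γ₊)` inside it. -/

theorem hasSum_norm_sq (f : Ell2 W) : HasSum (fun x => ‖f x‖ ^ 2) (‖f‖ ^ 2) := by
  simpa using lp.hasSum_norm (p := 2) (by norm_num) f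

theorem summable_norm_mul_norm (f g : Ell2 W) : Summable fun x => ‖f x‖ * ‖g x‖ := by
  refine Summable.of_nonneg_of_le (fun x => by positivity) (fun x => ?_)
    ((hasSum_norm_sq f).summable.add (hasSum_norm_sq g).summable)
  nlinarith [sq_nonneg (‖f x‖ - ‖g x‖), sq_nonneg (‖f x‖), sq_nonneg (‖g x‖)]

theorem summable_natCast_mul_norm_sq {s : W → ℕ} (hs : ∃ C : ℕ, ∀ x, s x ≤ C) (f : Ell2 W) :
    Summable fun x => (s x : ℝ) * ‖f x‖ ^ 2 := by
  obtain ⟨C, hC⟩ := hs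
  refine Summable.of_nonneg_of_le (fun x => by positivity) (fun x => ?_)
    ((hasSum_norm_sq f).summable.mul_left (C : ℝ))
  have : (s x : ℝ) ≤ C := by exact_mod_cast hC x
  gcongr

/-- The adjacency form of a graph is dominated by any weight that dominates the degree. -/
theorem tsum_norm_adjOp_mul_le (G : SimpleGraph W) (hG : BoundedDegree G) {s : W → ℕ}
    (hs : ∃ C : ℕ, ∀ x, s x ≤ C) (hdeg : ∀ x, (nbrs G hG x).card ≤ s x) (f : Ell2 W) :
    ∑' x, ‖adjOp G hG f x‖ * ‖f x‖ ≤ ∑' x, (s x : ℝ) * ‖f x‖ ^ 2 := by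
  classical
  have hsum := summable_natCast_mul_norm_sq hs f
  refine (summable_norm_mul_norm _ f).tsum_le_of_sum_le fun F => ?_
  let t := F.biUnion (nbrs G hG)
  -- AM-GM on each edge. Each of the two resulting sums is bounded by the weighted sum, the second
  -- after exchanging the order of summation and using the symmetry of adjacency.
  have h1 : ∀ x ∈ F, 2 * (‖adjOp G hG f x‖ * ‖f x‖) ≤
      (s x : ℝ) * ‖f x‖ ^ 2 + ∑ y ∈ nbrs G hG x, ‖f y‖ ^ 2 := by
    intro x _
    have hd : ((nbrs G hG x).card : ℝ) ≤ s x := by exact_mod_cast hdeg x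
    calc 2 * (‖adjOp G hG f x‖ * ‖f x‖) ≤ 2 * ((∑ y ∈ nbrs G hG x, ‖f y‖) * ‖f x‖) := by
          gcongr; exact norm_sum_le _ _
      _ = ∑ y ∈ nbrs G hG x, 2 * (‖f y‖ * ‖f x‖) := by rw [Finset.sum_mul, Finset.mul_sum]
      _ ≤ ∑ y ∈ nbrs G hG x, (‖f x‖ ^ 2 + ‖f y‖ ^ 2) := by
          gcongr with y _
          nlinarith [sq_nonneg (‖f x‖ - ‖f y‖)]
      _ = (nbrs G hG x).card * ‖f x‖ ^ 2 + ∑ y ∈ nbrs G hG x, ‖f y‖ ^ 2 := by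
          rw [Finset.sum_add_distrib, Finset.sum_const, nsmul_eq_mul]
      _ ≤ _ := by gcongr
  have h2 : ∑ x ∈ F, ∑ y ∈ nbrs G hG x, ‖f y‖ ^ 2 =
      ∑ y ∈ t, ∑ x ∈ F with y ∈ nbrs G hG x, ‖f y‖ ^ 2 := by
    refine Finset.sum_comm' fun x y => ?_
    simp only [t, Finset.mem_biUnion, Finset.mem_filter]
    exact ⟨fun h => ⟨h, x, h⟩, fun h => h.1⟩
  have h3 : ∀ y ∈ t, ∑ x ∈ F with y ∈ nbrs G hG x, ‖f y‖ ^ 2 ≤ (s y : ℝ) * ‖f y‖ ^ 2 := by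
    intro y _
    rw [Finset.sum_const, nsmul_eq_mul]
    gcongr
    refine (Finset.card_le_card fun x hx => ?_).trans (hdeg y)
    simpa [SimpleGraph.adj_comm] using (Finset.mem_filter.1 hx).2
  have h4 := Finset.sum_le_sum h1
  rw [← Finset.mul_sum, Finset.sum_add_distrib, h2] at h4
  have h5 := Finset.sum_le_sum h3
  have h6 := hsum.sum_le_tsum F fun x _ => by positivity
  have h7 := hsum.sum_le_tsum t fun x _ => by positivity
  linarith

/-- The operator `-(1/(2Δ)) A + (1/2) D` of a graph with weight `s`. -/
def weightedHam (G : SimpleGraph W) (hG : BoundedDegree G) (s : W → ℕ)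
    (hs : ∃ C : ℕ, ∀ x, s x ≤ C) (Δ : ℝ) : Ell2 W →L[ℂ] Ell2 W :=
  (-(1 / (2 * (Δ : ℂ)))) • adjOp G hG + (1 / 2 : ℂ) • mulOp s hs

/-- The reflection `1 - 2 · 1_p` associated with a set of indices. -/
def reflOp (p : W → Prop) [DecidablePred p] : Ell2 W →L[ℂ] Ell2 W :=
  1 - (2 : ℂ) • mulOp (fun x => if p x then 1 else 0) ⟨1, fun x => by split_ifs <;> simp⟩

theorem reflOp_apply (p : W → Prop) [DecidablePred p] (f : Ell2 W) (x : W) :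
    reflOp p f x = if p x then -f x else f x := by
  have : reflOp p f x = f x - 2 * (((if p x then 1 else 0 : ℕ) : ℂ) * f x) := rfl
  rw [this]
  split_ifs <;> push_cast <;> ring

theorem reflOp_mul_self (p : W → Prop) [DecidablePred p] : reflOp p * reflOp p = 1 := by
  ext f x
  change reflOp p (reflOp p f) x = f x
  rw [reflOp_apply, reflOp_apply]
  split_ifs <;> simp

theorem norm_reflOp_apply_le (p : W → Prop) [DecidablePred p] (f : Ell2 W) :
    ‖reflOp p f‖ ≤ ‖f‖ :=
  lp.norm_mono (by norm_num) fun x => by rw [reflOp_apply]; split_ifs <;> simp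

/-- Off the spectrum of the weight, the Hamiltonian composed with a reflection is coercive. -/
theorem mul_norm_sq_le_re_inner (G : SimpleGraph W) (hG : BoundedDegree G) {s : W → ℕ}
    (hs : ∃ C : ℕ, ∀ x, s x ≤ C) (hdeg : ∀ x, (nbrs G hG x).card ≤ s x) {Δ E c : ℝ} (hΔ : 0 < Δ)
    (hc : ∀ x, c ≤ |(s x : ℝ) / 2 - E| - s x / (2 * Δ)) (f : Ell2 W) :
    c * ‖f‖ ^ 2 ≤ (⟪(reflOp (fun x => (s x : ℝ) / 2 < E) *
      (weightedHam G hG s hs Δ - algebraMap ℂ _ (E : ℂ))) f, f⟫_ℂ).re := by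
  set T := reflOp (fun x => (s x : ℝ) / 2 < E) *
      (weightedHam G hG s hs Δ - algebraMap ℂ _ (E : ℂ)) with hT
  have hin : HasSum (fun x => (⟪T f x, f x⟫_ℂ).re) (⟪T f, f⟫_ℂ).re :=
    Complex.hasSum_re (lp.hasSum_inner (T f) f)
  have hA := (summable_norm_mul_norm (adjOp G hG f) f)
  have hD := summable_natCast_mul_norm_sq hs f
  have hle := tsum_norm_adjOp_mul_le G hG hs hdeg f
  -- Minorant for the inner product: `c|f|² + (s|f|² - |Af||f|)/(2Δ)`. The bracket may be negative
  -- at a point, but its sum is nonnegative by `hle`.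
  have hsum := (((hasSum_norm_sq f).mul_left c).add (hD.hasSum.mul_left (1 / (2 * Δ)))).sub
    (hA.hasSum.mul_left (1 / (2 * Δ)))
  have key := hasSum_le (fun x => ?_) hsum hin
  · have : 0 ≤ 1 / (2 * Δ) := by positivity
    nlinarith [mul_le_mul_of_nonneg_left hle this]
  set a := adjOp G hG f x with ha
  have hre : |(a * (starRingEnd ℂ) (f x)).re| ≤ ‖a‖ * ‖f x‖ := by
    simpa using Complex.abs_re_le_norm (a * (starRingEnd ℂ) (f x))
  have hTf : T f x = (if (s x : ℝ) / 2 < E then (-1 : ℝ) else (1 : ℝ) : ℝ) *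
      (((-(1 / (2 * Δ)) : ℝ) : ℂ) * a + (((s x : ℝ) / 2 - E : ℝ) : ℂ) * f x) := by
    have h1 : (weightedHam G hG s hs Δ - algebraMap ℂ _ (E : ℂ)) f x =
      -(1 / (2 * (Δ : ℂ))) * a + 1 / 2 * ((s x : ℂ) * f x) - E * f x := rfl
    change reflOp _ ((weightedHam G hG s hs Δ - algebraMap ℂ _ (E : ℂ)) f) x = _
    rw [reflOp_apply, h1]
    split_ifs <;> push_cast <;> ring
  have hval : (⟪T f x, f x⟫_ℂ).re = (if (s x : ℝ) / 2 < E then (-1 : ℝ) else (1 : ℝ)) *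
      (-(1 / (2 * Δ)) * (a * (starRingEnd ℂ) (f x)).re + ((s x : ℝ) / 2 - E) * ‖f x‖ ^ 2) := by
    rw [hTf, RCLike.inner_apply', ← Complex.normSq_eq_norm_sq, Complex.normSq_apply]
    simp only [Complex.mul_re, Complex.conj_re, Complex.conj_im, Complex.add_re, Complex.add_im,
      Complex.mul_im, Complex.ofReal_re, Complex.ofReal_im, map_mul, map_add, Complex.conj_ofReal]
    ring
  rw [hval]
  have hΔ' : 0 < 1 / (2 * Δ) := by positivity
  have hcx := mul_le_mul_of_nonneg_right (hc x) (sq_nonneg ‖f x‖)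
  have hp := (abs_le.1 hre)
  have hl := mul_le_mul_of_nonneg_left hp.1 hΔ'.le
  have hr := mul_le_mul_of_nonneg_left hp.2 hΔ'.le
  have hdiv : (s x : ℝ) / (2 * Δ) = 1 / (2 * Δ) * s x := by ring
  rw [hdiv] at hcx
  -- The sign of the reflection is that of `s/2 - E`, so both cases give `|s/2 - E| |f|²` minus at
  -- most `|Af||f|/(2Δ)`.
  split_ifs with h
  · rw [abs_of_neg (by linarith)] at hcx
    linarith
  · rw [abs_of_nonneg (by linarith)] at hcx
    linarith

/-- Cauchy–Schwarz applied to the coercivity bound, the reflection being a contraction. This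
quantitative form gives inverses bounded uniformly in `N`. -/
theorem mul_norm_le_norm_weightedHam_sub (G : SimpleGraph W) (hG : BoundedDegree G) {s : W → ℕ}
    (hs : ∃ C : ℕ, ∀ x, s x ≤ C) (hdeg : ∀ x, (nbrs G hG x).card ≤ s x) {Δ E c : ℝ} (hΔ : 0 < Δ)
    (hc : ∀ x, c ≤ |(s x : ℝ) / 2 - E| - s x / (2 * Δ)) (f : Ell2 W) :
    c * ‖f‖ ≤ ‖(weightedHam G hG s hs Δ - algebraMap ℂ _ (E : ℂ)) f‖ := by
  have h := mul_norm_sq_le_re_inner G hG hs hdeg hΔ hc f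
  have h1 := (Complex.re_le_norm _).trans (norm_inner_le_norm (𝕜 := ℂ)
    ((reflOp (fun x => (s x : ℝ) / 2 < E) *
      (weightedHam G hG s hs Δ - algebraMap ℂ _ (E : ℂ))) f) f)
  have h2 := norm_reflOp_apply_le (fun x => (s x : ℝ) / 2 < E)
    ((weightedHam G hG s hs Δ - algebraMap ℂ _ (E : ℂ)) f)
  rcases (norm_nonneg f).eq_or_lt with h0 | h0
  · rw [← h0, mul_zero]; exact norm_nonneg _
  · refine le_of_mul_le_mul_right ?_ h0
    calc c * ‖f‖ * ‖f‖ = c * ‖f‖ ^ 2 := by ring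
      _ ≤ _ := h.trans h1
      _ ≤ _ := by gcongr; exact h2

theorem isUnit_weightedHam_sub (G : SimpleGraph W) (hG : BoundedDegree G) {s : W → ℕ}
    (hs : ∃ C : ℕ, ∀ x, s x ≤ C) (hdeg : ∀ x, (nbrs G hG x).card ≤ s x) {Δ E c : ℝ} (hΔ : 0 < Δ)
    (hc0 : 0 < c) (hc : ∀ x, c ≤ |(s x : ℝ) / 2 - E| - s x / (2 * Δ)) :
    IsUnit (weightedHam G hG s hs Δ - algebraMap ℂ _ (E : ℂ)) := by
  have hU : IsUnit (reflOp (fun x => (s x : ℝ) / 2 < E)) :=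
    ⟨⟨_, _, reflOp_mul_self _, reflOp_mul_self _⟩, rfl⟩
  -- The reflection is its own inverse, so it suffices to invert the coercive product.
  rw [← hU.mul_left_iff]
  refine ContinuousLinearMap.isUnit_of_forall_le_norm_inner_map _ (c := ⟨c, hc0.le⟩) hc0 fun f => ?_
  have := (mul_norm_sq_le_re_inner G hG hs hdeg hΔ hc f).trans (Complex.re_le_norm _)
  rw [mul_comm]
  exact this

end Weighted

/-! ### Resolvent of a direct sum -/

section DirectSum

variable {ι : Type*} {E : ι → Type*} [∀ i, NormedAddCommGroup (E i)] [∀ i, NormedSpace ℂ (E i)]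

/-- A point of the resolvent sets of all summands, with uniformly bounded below differences,
belongs to the resolvent set of the direct sum. -/
theorem mem_pmapResolventSet_directSum (T : ∀ i, E i →L[ℂ] E i) (z : ℂ) {c : ℝ} (hc : 0 < c)
    (hunit : ∀ i, IsUnit (T i - algebraMap ℂ _ z))
    (hbound : ∀ i x, c * ‖x‖ ≤ ‖(T i - algebraMap ℂ _ z) x‖) :
    z ∈ pmapResolventSet (directSum T) := by
  have hex : ∀ i, ∃ R : E i →L[ℂ] E i, (∀ y, T i (R y) - z • R y = y) ∧
      ∀ x, R (T i x - z • x) = x := by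
    intro i
    obtain ⟨u, hu⟩ := hunit i
    have hv : ∀ x, T i x - z • x = u.1 x := fun x => by rw [hu]; rfl
    refine ⟨(u⁻¹).1, fun y => ?_, fun x => ?_⟩
    · rw [hv]; exact congrArg (fun S => S y) u.mul_inv
    · rw [hv]; exact congrArg (fun S => S x) u.inv_mul
  choose R hR1 hR2 using hex
  have hRn : ∀ i, ‖R i‖ ≤ c⁻¹ := fun i =>
    ContinuousLinearMap.opNorm_le_bound _ (by positivity) fun y => by
      have h : c * ‖R i y‖ ≤ ‖y‖ := by
        have := hbound i (R i y)
        rwa [show (T i - algebraMap ℂ _ z) (R i y) = y from hR1 i y] at this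
      rw [inv_mul_eq_div, le_div_iff₀' hc]
      exact h
  refine ⟨lp.mapCLM 2 R (K := c⁻¹) (by positivity) hRn, fun y => ?_, fun x => ?_⟩
  · set r := lp.mapCLM 2 R (K := c⁻¹) (by positivity) hRn y with hr
    have hri : ∀ i, T i (r i) = y i + z • r i := fun i => sub_eq_iff_eq_add.1 (hR1 i (y i))
    refine ⟨?_, ?_⟩
    · change Memℓp (fun i => T i (r i)) 2
      -- The resolvent equation `T r = y + z r` puts `r` in the natural domain.
      rw [show (fun i => T i (r i)) = ⇑(y + z • r) from funext hri]
      exact lp.memℓp _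
    · ext i
      exact hR1 i (y i)
  · ext i
    exact hR2 i (x.1 i)

end DirectSum


/-! ### Surface measure and degree on the chain -/

/-- The sites `n` of the chain such that exactly one of `n`, `n + 1` belongs to `X`. -/
def leftBoundary (X : Finset ℤ) : Finset ℤ := symmDiff X (X.image (· - 1))

theorem mem_leftBoundary {X : Finset ℤ} {n : ℤ} :
    n ∈ leftBoundary X ↔ n ∈ X ∧ n + 1 ∉ X ∨ n + 1 ∈ X ∧ n ∉ X := by
  have : ∀ m : ℤ, m - 1 = n ↔ m = n + 1 := fun m => by omega
  simp [leftBoundary, Finset.mem_symmDiff, this]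

/-- `X` and its translate have equally many elements, so the two halves of their symmetric
difference do too. -/
theorem even_card_leftBoundary (X : Finset ℤ) : Even (leftBoundary X).card := by
  have hcard : (X.image (· - 1)).card = X.card :=
    Finset.card_image_of_injective _ (sub_left_injective)
  have h1 := Finset.card_sdiff_add_card_inter X (X.image (· - 1))
  have h2 := Finset.card_sdiff_add_card_inter (X.image (· - 1)) X
  have h3 : (leftBoundary X).card = (X \ X.image (· - 1)).card + (X.image (· - 1) \ X).card :=
    Finset.card_union_of_disjoint disjoint_sdiff_sdiff
  rw [Finset.inter_comm] at h2
  exact ⟨(X \ X.image (· - 1)).card, by omega⟩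

theorem edgeBoundary_chain (X : Finset ℤ) :
    edgeBoundary chain X = ((leftBoundary X).image fun n => s(n, n + 1) : Finset (Sym2 ℤ)) := by
  ext e
  simp only [edgeBoundary, Set.mem_ofPred_eq, Finset.coe_image, Set.mem_image, Finset.mem_coe,
    mem_leftBoundary]
  constructor
  · rintro ⟨x, hx, y, hy, hxy, rfl⟩
    have h : |x - y| = 1 := hxy
    rcases (abs_eq (by norm_num)).1 h with h | h
    · obtain rfl : x = y + 1 := by omega
      exact ⟨y, Or.inr ⟨hx, hy⟩, Sym2.eq_swap⟩
    · obtain rfl : y = x + 1 := by omega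
      exact ⟨x, Or.inl ⟨hx, hy⟩, rfl⟩
  · rintro ⟨n, ⟨h1, h2⟩ | ⟨h1, h2⟩, rfl⟩
    · exact ⟨n, h1, n + 1, h2, by simp [chain], rfl⟩
    · exact ⟨n + 1, h1, n, h2, by simp [chain], Sym2.eq_swap⟩

theorem surface_chain (X : Finset ℤ) : surface chain X = (leftBoundary X).card := by
  rw [surface, edgeBoundary_chain, Set.ncard_coe_finset, Finset.card_image_of_injective]
  intro m n h
  rcases Sym2.eq_iff.1 h with ⟨h, -⟩ | ⟨h, h'⟩
  · exact h
  · omega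

/-- Twice the number of clusters: the surface measure on the chain is even. -/
theorem even_surface_chain (X : Finset ℤ) : Even (surface chain X) := by
  rw [surface_chain]; exact even_card_leftBoundary X

/-- A neighbour is determined by the edge `{n, n + 1}` along which a particle hops, and conservation
of the particle number forces that edge to be a boundary edge of `X`. -/
theorem card_nbrs_symProd_chain_le {N : ℕ} (h : BoundedDegree (symProd chain N))
    (X : Config ℤ N) : (nbrs (symProd chain N) h X).card ≤ surface chain X.1 := by
  rw [surface_chain, ← Finset.card_image_of_injective _ Subtype.val_injective]
  refine (Finset.card_le_card (t := (leftBoundary X.1).image fun n => symmDiff X.1 {n, n + 1})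
    fun Z hZ => ?_).trans Finset.card_image_le
  obtain ⟨Y, hY, rfl⟩ := Finset.mem_image.1 hZ
  obtain ⟨x, y, hxy, e⟩ := (mem_nbrs _ _ _ _).1 hY
  have hYX : Y.1 = symmDiff X.1 {x, y} := by rw [← e, symmDiff_symmDiff_cancel_left]
  obtain ⟨n, hn⟩ : ∃ n : ℤ, ({x, y} : Finset ℤ) = {n, n + 1} := by
    have h : |x - y| = 1 := hxy
    rcases (abs_eq (by norm_num)).1 h with h | h
    · exact ⟨y, by rw [Finset.pair_comm, show x = y + 1 by omega]⟩
    · exact ⟨x, by rw [show y = x + 1 by omega]⟩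
  rw [hn] at hYX e
  refine Finset.mem_image.2 ⟨n, ?_, hYX.symm⟩
  have h1 := Finset.card_sdiff_add_card_inter X.1 Y.1
  have h2 := Finset.card_sdiff_add_card_inter Y.1 X.1
  rw [Finset.inter_comm, Y.2] at h2
  rw [X.2] at h1
  rw [mem_leftBoundary]
  -- If both or neither of `n`, `n + 1` were in `X`, one of `X \ Y`, `Y \ X` would be empty and the
  -- other not, though they have equal size.
  by_contra hcon
  have hiff : n ∈ X.1 ↔ n + 1 ∈ X.1 := by tauto
  have hc : (X.1 \ Y.1).card = (Y.1 \ X.1).card := by omega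
  have hmem : ∀ m, m ∈ X.1 ∧ m ∉ Y.1 ∨ m ∈ Y.1 ∧ m ∉ X.1 ↔ m = n ∨ m = n + 1 := fun m => by
    rw [← Finset.mem_symmDiff, e]; simp
  by_cases hX : n ∈ X.1
  · have hX' := hiff.1 hX
    have h3 : Y.1 \ X.1 = ∅ := by
      ext m
      have := hmem m
      simp only [Finset.mem_sdiff, Finset.notMem_empty, iff_false]
      rintro ⟨ha, hb⟩
      rcases this.1 (Or.inr ⟨ha, hb⟩) with rfl | rfl <;> exact hb ‹_›
    have h4 : n ∈ X.1 \ Y.1 := by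
      have := (hmem n).2 (Or.inl rfl)
      rw [Finset.mem_sdiff]; tauto
    rw [h3, Finset.card_empty, Finset.card_eq_zero] at hc
    simp [hc] at h4
  · have hX' : n + 1 ∉ X.1 := fun h => hX (hiff.2 h)
    have h3 : X.1 \ Y.1 = ∅ := by
      ext m
      have := hmem m
      simp only [Finset.mem_sdiff, Finset.notMem_empty, iff_false]
      rintro ⟨ha, hb⟩
      rcases this.1 (Or.inl ⟨ha, hb⟩) with rfl | rfl <;> exact absurd ha ‹_›
    have h4 : n ∈ Y.1 \ X.1 := by
      have := (hmem n).2 (Or.inl rfl)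
      rw [Finset.mem_sdiff]; tauto
    rw [h3, Finset.card_empty, eq_comm, Finset.card_eq_zero] at hc
    simp [hc] at h4

/-- With `S = 2w` the right side is `|w - E| - w/Δ`, smallest at `w = k` or `w = k + 1`; so `c` is
the distance from `E` to the nearer edge of the gap. -/
theorem exists_le_surface_chain_gap {k : ℕ} {Δ E : ℝ} (hΔ : 1 < Δ)
    (hE : E ∈ Set.Ioo ((k : ℝ) * (1 + 1 / Δ)) (((k : ℝ) + 1) * (1 - 1 / Δ))) :
    ∃ c : ℝ, 0 < c ∧ ∀ X : Finset ℤ,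
      c ≤ |(surface chain X : ℝ) / 2 - E| - surface chain X / (2 * Δ) := by
  have h0 : 0 < 1 / Δ := by positivity
  have h1 : 1 / Δ < 1 := by rw [div_lt_one (by linarith)]; exact hΔ
  refine ⟨min (E - k * (1 + 1 / Δ)) ((k + 1) * (1 - 1 / Δ) - E),
    lt_min (by linarith [hE.1]) (by linarith [hE.2]), fun X => ?_⟩
  obtain ⟨w, hw⟩ := even_surface_chain X
  have h2 : (surface chain X : ℝ) / 2 = w := by rw [hw]; push_cast; ring
  have h3 : (surface chain X : ℝ) / (2 * Δ) = w * (1 / Δ) := by rw [hw]; push_cast; ring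
  rw [h2, h3]
  rcases Nat.lt_or_ge k w with h | h
  · have hkw : (k : ℝ) + 1 ≤ w := by exact_mod_cast h
    refine (min_le_right _ _).trans ?_
    have := le_abs_self ((w : ℝ) - E)
    nlinarith [mul_le_mul_of_nonneg_right hkw (sub_nonneg.2 h1.le)]
  · have hkw : (w : ℝ) ≤ k := by exact_mod_cast h
    refine (min_le_left _ _).trans ?_
    have := neg_le_abs ((w : ℝ) - E)
    nlinarith [mul_le_mul_of_nonneg_right hkw h0.le]

theorem isUnit_chainHamN_sub {Δ E c : ℝ} (hΔ : 0 < Δ) (hc0 : 0 < c)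
    (hc : ∀ X : Finset ℤ, c ≤ |(surface chain X : ℝ) / 2 - E| - surface chain X / (2 * Δ))
    (N : ℕ) : IsUnit (chainHamN Δ N - algebraMap ℂ _ (E : ℂ)) :=
  isUnit_weightedHam_sub _ _ (surface_bounded chain_boundedDegree N)
    (card_nbrs_symProd_chain_le _) hΔ hc0 fun X => hc X.1

theorem mul_norm_le_norm_chainHamN_sub {Δ E c : ℝ} (hΔ : 0 < Δ)
    (hc : ∀ X : Finset ℤ, c ≤ |(surface chain X : ℝ) / 2 - E| - surface chain X / (2 * Δ))
    (N : ℕ) (f : Ell2 (Config ℤ N)) :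
    c * ‖f‖ ≤ ‖(chainHamN Δ N - algebraMap ℂ _ (E : ℂ)) f‖ :=
  mul_norm_le_norm_weightedHam_sub _ _ (surface_bounded chain_boundedDegree N)
    (card_nbrs_symProd_chain_le _) hΔ (fun X => hc X.1) f

/-! ### Position of the interval and conclusion -/

theorem Ioo_gamma_subset {k : ℕ} {Δ : ℝ} (hΔ : 4 * (k : ℝ) + 1 < Δ) :
    Set.Ioo (gammaMinus k Δ) (gammaPlus k Δ) ⊆
      Set.Ioo ((k : ℝ) * (1 + 1 / Δ)) (((k : ℝ) + 1) * (1 - 1 / Δ)) := by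
  have hk : (0 : ℝ) ≤ k := k.cast_nonneg
  have hΔ0 : 0 < Δ := by linarith
  -- AM-GM: `Δ - (2k + 1)` is the mean of the two factors, and its square exceeds their product by
  -- `4k²`. Replacing the root by this mean turns `γ₋`, `γ₊` into exactly the ends of the gap.
  have hs : √((Δ - 1) * (Δ - (4 * k + 1))) ≤ Δ - (2 * k + 1) :=
    Real.sqrt_le_iff.2 ⟨by linarith, by nlinarith [sq_nonneg (k : ℝ)]⟩
  have h := mul_le_mul_of_nonneg_left hs (show 0 ≤ 1 / (2 * Δ) by positivity)
  have e : 1 / (2 * Δ) * (Δ - (2 * k + 1)) = 1 / 2 - (k + 1 / 2) * (1 / Δ) := by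
    field_simp
  rw [e] at h
  rintro E ⟨h1, h2⟩
  unfold gammaMinus at h1
  unfold gammaPlus at h2
  constructor <;> nlinarith

theorem gammaMinus_lt_gammaPlus {k : ℕ} {Δ : ℝ} (hΔ : 4 * (k : ℝ) + 1 < Δ) :
    gammaMinus k Δ < gammaPlus k Δ := by
  have hk : (0 : ℝ) ≤ k := k.cast_nonneg
  have hΔ0 : 0 < Δ := by linarith
  have : 0 < 1 / (2 * Δ) * √((Δ - 1) * (Δ - (4 * k + 1))) :=
    mul_pos (by positivity) (Real.sqrt_pos.2 (mul_pos (by linarith) (by linarith)))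
  unfold gammaMinus gammaPlus
  linarith

end XXZ
end

theorem proposition4p1 (k : ℕ) (hk : 2 ≤ k) (Δ : ℝ) (hΔ : 4 * (k : ℝ) + 1 < Δ) :
    XXZ.gammaMinus k Δ < XXZ.gammaPlus k Δ ∧
    Set.Ioo (XXZ.gammaMinus k Δ) (XXZ.gammaPlus k Δ) ⊆
      Set.Ioo ((k : ℝ) * (1 + 1 / Δ)) (((k : ℝ) + 1) * (1 - 1 / Δ)) ∧
    (∀ E ∈ Set.Ioo (XXZ.gammaMinus k Δ) (XXZ.gammaPlus k Δ),
      (∀ a ∈ XXZ.clusterBand k Δ, a < E) ∧ (∀ b ∈ XXZ.clusterBand (k + 1) Δ, E < b)) ∧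
    (∀ E ∈ Set.Ioo (XXZ.gammaMinus k Δ) (XXZ.gammaPlus k Δ),
      (E : ℂ) ∈ XXZ.pmapResolventSet (XXZ.chainHam Δ)) ∧
    (∀ N : ℕ, ∀ E ∈ Set.Ioo (XXZ.gammaMinus k Δ) (XXZ.gammaPlus k Δ),
      (E : ℂ) ∈ resolventSet ℂ (XXZ.chainHamN Δ N)) := by
  have hk0 : (0 : ℝ) ≤ k := k.cast_nonneg
  have hΔ1 : 1 < Δ := by linarith
  have hΔ0 : 0 < Δ := by linarith
  have hsub := XXZ.Ioo_gamma_subset hΔ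
  refine ⟨XXZ.gammaMinus_lt_gammaPlus hΔ, hsub, fun E hE => ⟨fun a ha => ?_, fun b hb => ?_⟩,
    fun E hE => ?_, fun N E hE => ?_⟩
  · exact ha.2.trans_lt (hsub hE).1
  · refine (hsub hE).2.trans_le ?_
    simpa using hb.1
  · obtain ⟨c, hc0, hc⟩ := XXZ.exists_le_surface_chain_gap hΔ1 (hsub hE)
    exact XXZ.mem_pmapResolventSet_directSum _ _ hc0 (XXZ.isUnit_chainHamN_sub hΔ0 hc0 hc)
      (XXZ.mul_norm_le_norm_chainHamN_sub hΔ0 hc)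
  · obtain ⟨c, hc0, hc⟩ := XXZ.exists_le_surface_chain_gap hΔ1 (hsub hE)
    have h := (XXZ.isUnit_chainHamN_sub hΔ0 hc0 hc N).neg
    rwa [neg_sub] at h
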